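/- Let $v>1$. Two robots, a sender $S$ and a receiver $R$, and a bike start at the origin of the real line. At every moment at most one robot rides the bike; a robot that is not riding moves with speed at most $1$, a robot that is riding moves (together with the bike) with speed at most $v$, a robot can mount the bike only where the bike is, and the bike does not move unless it is ridden; mounting, dismounting, changing riders and turning take no time. An exit is located at one of the points $\pm d$, where both the distance $d>0$ and the sign are unknown to the robots; a robot recognizes the exit, the bike and the other robot only when it is at the same point as it. In the S/R model the receiver learns, at each moment and at any distance, whatever the sender knows, whereas the sender learns what the receiver knows only when the two robots are at the same point. A (deterministic) evacuation algorithm prescribes the motion of each robot, including when it rides the bike, as a function of the information that this robot has obtained so far. For an exit at $x\neq 0$ let $E(x)\in[0,\infty]$ be the first time at which both robots are at the exit, and let $\mathrm{OPT}(x)$ be the infimum of the evacuation times over all motions of the two robots and the bike when the position $x$ is known in advance. The competitive ratio of the algorithm is $\sup_{x\ne0}E(x)/\mathrm{OPT}(x)$. Then every evacuation algorithm for $S$ and $R$ with a bike of speed $v$ in the S/R model has competitive ratio at least $$\frac{6}{v+1}\ \text{ if } v\le 3,\qquad\qquad \frac{v^2+2v-3}{v^2-1}\ \text{ if } v>3 .$$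 Moreover, the same lower bound holds for $\max\{E(d)/\mathrm{OPT}(d),\,E(-d)/\mathrm{OPT}(-d)\}$ for every single distance $d>0$. -/

import Mathlib

namespace BikeEvac

/-- The two autonomous robots. -/
inductive Robot : Type
  | sender : Robot
  | receiver : Robot

/-- The motion of the ensemble: the velocity of each robot and the rider of the bike (if any) at
each time `t ≥ 0`. The bike has at most one rider at a time. -/
structure Motion where
  vel : Robot → ℝ → ℝ
  rider : ℝ → Option Robot

namespace Motion

/-- Position of robot `i` at time `t`; both robots start at the origin. -/
noncomputable def pos (M : Motion) (i : Robot) (t : ℝ) : ℝ :=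
  ∫ τ in (0 : ℝ)..t, M.vel i τ

/-- Velocity of the bike: that of its rider, and `0` when nobody rides it. -/
def bikeVel (M : Motion) (t : ℝ) : ℝ :=
  match M.rider t with
  | none => 0
  | some i => M.vel i t

/-- Position of the bike at time `t`; it starts at the origin. -/
noncomputable def bike (M : Motion) (t : ℝ) : ℝ :=
  ∫ τ in (0 : ℝ)..t, M.bikeVel τ

/-- Physical feasibility for a bike of speed `v`: a hiker has speed at most `1`, a biker has speed
at most `v`, and a robot can ride the bike only where the bike is. -/
structure Feasible (v : ℝ) (M : Motion) : Prop where
  measurable_vel : ∀ i, Measurable (M.vel i)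
  measurable_rider : ∀ i, MeasurableSet {t | M.rider t = some i}
  hiker_speed : ∀ i t, 0 ≤ t → M.rider t ≠ some i → |M.vel i t| ≤ 1
  biker_speed : ∀ i t, 0 ≤ t → M.rider t = some i → |M.vel i t| ≤ v
  rider_at_bike : ∀ i t, 0 ≤ t → M.rider t = some i → M.bike t = M.pos i t

/-- Evacuation time for an exit at `x`: the first time at which both robots are at the exit
(a robot that is done waits there); it is `⊤` if there is no such time. -/
noncomputable def evacTime (M : Motion) (x : ℝ) : ENNReal :=
  ⨅ (T : ℝ) (_ : 0 ≤ T ∧ ∀ i, M.pos i T = x), ENNReal.ofReal T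

end Motion

/-- The receiver cannot tell by time `t` whether it is in the world with exit `x` and motion `M`
or in the world with exit `y` and motion `N`. It knows its own history (position, presence of the
exit, of the bike and of the sender at its location) and, since the sender can transmit over any
distance at all times, also the history of the sender. -/
def ReceiverIndist (x : ℝ) (M : Motion) (y : ℝ) (N : Motion) (t : ℝ) : Prop :=
  ∀ τ ∈ Set.Icc 0 t, ∀ i : Robot,
    M.pos i τ = N.pos i τ ∧
    (M.pos i τ = x ↔ N.pos i τ = y) ∧
    (M.bike τ = M.pos i τ ↔ N.bike τ = N.pos i τ)

/-- The sender cannot tell by time `t` whether it is in the world with exit `x` and motion `M`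
or in the world with exit `y` and motion `N`. It knows its own history (position, presence of the
exit, of the bike and of the receiver at its location) and, only when it is co-located with the
receiver, what the receiver knows at that moment. -/
def SenderIndist (x : ℝ) (M : Motion) (y : ℝ) (N : Motion) (t : ℝ) : Prop :=
  ∀ τ ∈ Set.Icc 0 t,
    M.pos .sender τ = N.pos .sender τ ∧
    (M.pos .sender τ = x ↔ N.pos .sender τ = y) ∧
    (M.bike τ = M.pos .sender τ ↔ N.bike τ = N.pos .sender τ) ∧
    (M.pos .receiver τ = M.pos .sender τ ↔ N.pos .receiver τ = N.pos .sender τ) ∧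
    (M.pos .receiver τ = M.pos .sender τ → ReceiverIndist x M y N τ)

/-- On some time interval starting at `t`, robot `i` acts (chooses its velocity, and whether it
rides the bike) in the same way in both motions. -/
def SameAction (i : Robot) (M N : Motion) (t : ℝ) : Prop :=
  ∃ ε > 0, ∀ τ ∈ Set.Ico t (t + ε),
    M.vel i τ = N.vel i τ ∧ (M.rider τ = some i ↔ N.rider τ = some i)

/-- A (deterministic) evacuation algorithm for the sender and the receiver sharing a bike of
speed `v` in the S/R model: the motion it produces for each position `x` of the exit, where
each robot acts on the information it has: as long as a robot cannot distinguish two positions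
of the exit, it goes on in the same way for both. -/
structure Algorithm (v : ℝ) where
  run : ℝ → Motion
  feasible : ∀ x, (run x).Feasible v
  sender_causal : ∀ x y t, 0 ≤ t → SenderIndist x (run x) y (run y) t →
    SameAction .sender (run x) (run y) t
  receiver_causal : ∀ x y t, 0 ≤ t → ReceiverIndist x (run x) y (run y) t →
    SameAction .receiver (run x) (run y) t

/-- The evacuation time needed when the position `x` of the exit is known to both robots. -/
noncomputable def optTime (v : ℝ) (x : ℝ) : ENNReal :=
  ⨅ (M : Motion) (_ : M.Feasible v), M.evacTime x

namespace Algorithm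

/-- Evacuation time of the algorithm for an exit at `x`, divided by the optimal one for a known
exit. -/
noncomputable def ratio {v : ℝ} (A : Algorithm v) (x : ℝ) : ENNReal :=
  (A.run x).evacTime x / optTime v x

/-- The ratio forced by an adversary who places the exit at one of the points `±d`. -/
noncomputable def ratioAtDistance {v : ℝ} (A : Algorithm v) (d : ℝ) : ENNReal :=
  max (A.ratio d) (A.ratio (-d))

/-- The competitive ratio: the worst case over all distances `d > 0`. -/
noncomputable def competitiveRatio {v : ℝ} (A : Algorithm v) : ENNReal :=
  ⨆ (d : ℝ) (_ : 0 < d), A.ratioAtDistance d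

end Algorithm

end BikeEvac

/-! Until a robot first visits one of `±d`, the runs for the two exits coincide, so the adversary
puts the exit at the other point (`exists_wrong_visit`). In the run for that exit `x`, some robot is
at `-x` before evacuation and travels at least `3|x|`; at speed at most `v` this gives `T ≥ 3|x|/v`.
The second bound counts hiking time. The robots together hike for at least `|x|`
(`le_integral_hike`), while a robot that hikes for time `H` covers at most `vT - (v-1)H`. Adding
these bounds for distances `3|x|` and `|x|` gives `2vT ≥ 4|x| + (v-1)|x|`, that is `T ≥
|x|(v+3)/(2v)`. A relay shows `OPT(x) ≤ |x|(v+1)/(2v)`; dividing gives `6/(v+1)` and `(v+3)/(v+1)`,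
which cross at `v = 3`. -/

namespace BikeEvac

/-! ### Hiking time, reflection and primitives of bounded functions. -/

namespace Motion

/-- The indicator of the times at which robot `i` does not ride the bike. -/
noncomputable def hike (M : Motion) (i : Robot) (t : ℝ) : ℝ :=
  open Classical in if M.rider t = some i then 0 else 1

/-- The mirror image of a motion. -/
def reflect (M : Motion) : Motion where
  vel i t := -M.vel i t
  rider := M.rider

lemma reflect_pos (M : Motion) (i : Robot) (t : ℝ) : M.reflect.pos i t = -M.pos i t := by
  simp [pos, reflect]

lemma reflect_bike (M : Motion) (t : ℝ) : M.reflect.bike t = -M.bike t := by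
  have h : ∀ τ, M.reflect.bikeVel τ = -M.bikeVel τ := by
    intro τ
    unfold bikeVel
    simp only [reflect]
    cases M.rider τ <;> simp
  simp [bike, h]

lemma Feasible.reflect {v : ℝ} {M : Motion} (hM : M.Feasible v) : M.reflect.Feasible v where
  measurable_vel i := (hM.measurable_vel i).neg
  measurable_rider := hM.measurable_rider
  hiker_speed i t ht h := by
    simpa [Motion.reflect] using hM.hiker_speed i t ht h
  biker_speed i t ht h := by
    simpa [Motion.reflect] using hM.biker_speed i t ht h
  rider_at_bike i t ht h := by
    rw [reflect_bike, reflect_pos, hM.rider_at_bike i t ht h]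

/-- At most one of the two factors `1 - hike` is nonzero. This form gives measurability and makes
the riding terms cancel in `pos_add_pos_sub_bike_le`. -/
lemma bikeVel_eq (M : Motion) (t : ℝ) :
    M.bikeVel t = (1 - M.hike .sender t) * M.vel .sender t
      + (1 - M.hike .receiver t) * M.vel .receiver t := by
  unfold bikeVel hike
  rcases h : M.rider t with _ | _ | _ <;> simp

lemma hike_nonneg (M : Motion) (i : Robot) (t : ℝ) : 0 ≤ M.hike i t := by
  unfold hike; split_ifs <;> norm_num

lemma hike_le_one (M : Motion) (i : Robot) (t : ℝ) : M.hike i t ≤ 1 := by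
  unfold hike; split_ifs <;> norm_num

/-- A measurable function that is bounded on `[0, ∞)` is integrable on intervals there. -/
lemma intervalIntegrable_of_bound {f : ℝ → ℝ} (hf : Measurable f) {C : ℝ}
    (hC : ∀ t, 0 ≤ t → |f t| ≤ C) {a b : ℝ} (ha : 0 ≤ a) (hb : 0 ≤ b) :
    IntervalIntegrable f MeasureTheory.volume a b := by
  refine (intervalIntegrable_const (c := C)).mono_fun hf.aestronglyMeasurable ?_
  refine (MeasureTheory.ae_restrict_iff' measurableSet_uIoc).2 (.of_forall fun t ht => ?_)
  have h0 : 0 ≤ t := (le_min ha hb).trans ht.1.le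
  exact (hC t h0).trans (le_abs_self C)

/-- A primitive of a bounded measurable function is Lipschitz on `[0, ∞)`. -/
lemma continuousOn_primitive_of_bound {f : ℝ → ℝ} (hf : Measurable f) {C : ℝ}
    (hC : ∀ t, 0 ≤ t → |f t| ≤ C) :
    ContinuousOn (fun t => ∫ τ in (0 : ℝ)..t, f τ) (Set.Ici 0) := by
  have h0 : 0 ≤ C := (abs_nonneg _).trans (hC 0 le_rfl)
  refine LipschitzOnWith.continuousOn (K := C.toNNReal) (LipschitzOnWith.of_dist_le_mul ?_)
  intro a ha b hb
  have ha : 0 ≤ a := ha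
  have hb : 0 ≤ b := hb
  rw [Real.dist_eq, Real.dist_eq, Real.coe_toNNReal _ h0,
    intervalIntegral.integral_interval_sub_left (intervalIntegrable_of_bound hf hC le_rfl ha)
      (intervalIntegrable_of_bound hf hC le_rfl hb)]
  have h : ∀ t ∈ Set.uIoc b a, ‖f t‖ ≤ C := fun t ht => hC t ((le_min hb ha).trans ht.1.le)
  exact intervalIntegral.norm_integral_le_of_norm_le_const h

/-! ### Kinematics of feasible motions and lower bounds on evacuation time. -/

namespace Feasible

variable {v : ℝ} {M : Motion}

lemma measurable_hike (hM : M.Feasible v) (i : Robot) : Measurable (M.hike i) :=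
  Measurable.ite (hM.measurable_rider i) measurable_const measurable_const

lemma abs_vel_le_mix (hM : M.Feasible v) (i : Robot) {t : ℝ} (ht : 0 ≤ t) :
    |M.vel i t| ≤ M.hike i t + v * (1 - M.hike i t) := by
  unfold hike
  split_ifs with h
  · simpa using hM.biker_speed i t ht h
  · simpa using hM.hiker_speed i t ht h

lemma abs_vel_le (hv : 1 < v) (hM : M.Feasible v) (i : Robot) {t : ℝ} (ht : 0 ≤ t) :
    |M.vel i t| ≤ v := by
  have := hM.abs_vel_le_mix i ht
  nlinarith [M.hike_nonneg i t]

lemma measurable_bikeVel (hM : M.Feasible v) : Measurable M.bikeVel := by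
  have h : M.bikeVel = fun t => (1 - M.hike .sender t) * M.vel .sender t
      + (1 - M.hike .receiver t) * M.vel .receiver t := funext M.bikeVel_eq
  rw [h]
  exact ((measurable_const.sub (hM.measurable_hike _)).mul (hM.measurable_vel _)).add
    ((measurable_const.sub (hM.measurable_hike _)).mul (hM.measurable_vel _))

lemma abs_bikeVel_le (hv : 1 < v) (hM : M.Feasible v) {t : ℝ} (ht : 0 ≤ t) :
    |M.bikeVel t| ≤ v := by
  unfold bikeVel
  cases M.rider t with
  | none => simp; linarith
  | some i => exact hM.abs_vel_le hv i ht

lemma intervalIntegrable_vel (hv : 1 < v) (hM : M.Feasible v) (i : Robot) {a b : ℝ} (ha : 0 ≤ a)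
    (hb : 0 ≤ b) : IntervalIntegrable (M.vel i) MeasureTheory.volume a b :=
  intervalIntegrable_of_bound (hM.measurable_vel i) (fun _ ht => hM.abs_vel_le hv i ht) ha hb

lemma intervalIntegrable_hike (hM : M.Feasible v) (i : Robot) {a b : ℝ} (ha : 0 ≤ a)
    (hb : 0 ≤ b) : IntervalIntegrable (M.hike i) MeasureTheory.volume a b :=
  intervalIntegrable_of_bound (C := 1) (hM.measurable_hike i)
    (fun t _ => by rw [abs_of_nonneg (M.hike_nonneg i t)]; exact M.hike_le_one i t) ha hb

lemma continuousOn_pos (hv : 1 < v) (hM : M.Feasible v) (i : Robot) :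
    ContinuousOn (M.pos i) (Set.Ici 0) :=
  continuousOn_primitive_of_bound (hM.measurable_vel i) (fun _ ht => hM.abs_vel_le hv i ht)

lemma continuousOn_bike (hv : 1 < v) (hM : M.Feasible v) :
    ContinuousOn M.bike (Set.Ici 0) :=
  continuousOn_primitive_of_bound hM.measurable_bikeVel (fun _ ht => hM.abs_bikeVel_le hv ht)

lemma pos_sub_pos (hv : 1 < v) (hM : M.Feasible v) (i : Robot) {a b : ℝ} (ha : 0 ≤ a)
    (hb : 0 ≤ b) : M.pos i b - M.pos i a = ∫ τ in a..b, M.vel i τ :=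
  intervalIntegral.integral_interval_sub_left (hM.intervalIntegrable_vel hv i le_rfl hb)
    (hM.intervalIntegrable_vel hv i le_rfl ha)

/-- The distance covered is bounded by the time spent hiking plus `v` times the time spent
biking. -/
lemma abs_pos_sub_le (hv : 1 < v) (hM : M.Feasible v) (i : Robot) {a b : ℝ} (ha : 0 ≤ a)
    (hab : a ≤ b) :
    |M.pos i b - M.pos i a| ≤ v * (b - a) - (v - 1) * ∫ τ in a..b, M.hike i τ := by
  have hb := ha.trans hab
  rw [hM.pos_sub_pos hv i ha hb]
  have hi := hM.intervalIntegrable_hike i ha hb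
  have h : ‖∫ τ in a..b, M.vel i τ‖ ≤ ∫ τ in a..b, (v - (v - 1) * M.hike i τ) := by
    refine intervalIntegral.norm_integral_le_of_norm_le hab (.of_forall fun t ht => ?_)
      (intervalIntegrable_const.sub (hi.const_mul _))
    have := hM.abs_vel_le_mix i (ha.trans ht.1.le)
    rw [Real.norm_eq_abs]
    linarith
  rw [intervalIntegral.integral_sub intervalIntegrable_const (hi.const_mul _),
    intervalIntegral.integral_const, intervalIntegral.integral_const_mul, smul_eq_mul] at h
  rw [← Real.norm_eq_abs]
  linarith

lemma integral_hike_nonneg (M : Motion) (i : Robot) {a b : ℝ} (hab : a ≤ b) :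
    0 ≤ ∫ τ in a..b, M.hike i τ :=
  intervalIntegral.integral_nonneg hab fun t _ => M.hike_nonneg i t

/-- The sum of the positions of the robots minus that of the bike changes only by hiking. -/
lemma pos_add_pos_sub_bike_le (hv : 1 < v) (hM : M.Feasible v) {t : ℝ} (ht : 0 ≤ t) :
    M.pos .sender t + M.pos .receiver t - M.bike t ≤
      (∫ τ in (0 : ℝ)..t, M.hike .sender τ) + ∫ τ in (0 : ℝ)..t, M.hike .receiver τ := by
  have h1 := hM.intervalIntegrable_vel hv .sender le_rfl ht
  have h2 := hM.intervalIntegrable_vel hv .receiver le_rfl ht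
  have h3 : IntervalIntegrable M.bikeVel MeasureTheory.volume 0 t :=
    intervalIntegrable_of_bound hM.measurable_bikeVel (fun _ h => hM.abs_bikeVel_le hv h) le_rfl ht
  have h4 := hM.intervalIntegrable_hike .sender le_rfl ht
  have h5 := hM.intervalIntegrable_hike .receiver le_rfl ht
  unfold pos bike
  rw [← intervalIntegral.integral_add h1 h2, ← intervalIntegral.integral_sub (h1.add h2) h3,
    ← intervalIntegral.integral_add h4 h5]
  refine intervalIntegral.integral_mono_on ht ((h1.add h2).sub h3) (h4.add h5) fun τ hτ => ?_
  -- A rider's velocity cancels against that of the bike, so only the hiking part of each velocity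
  -- survives.
  have key : ∀ i, M.hike i τ * M.vel i τ ≤ M.hike i τ := by
    intro i
    unfold hike
    split_ifs with h
    · simp
    · simpa using (abs_le.1 (hM.hiker_speed i τ hτ.1 h)).2
  rw [bikeVel_eq]
  linarith [key .sender, key .receiver]

/-- While the bike is beyond `y`, a robot can advance towards `y` only by hiking. -/
lemma sub_pos_le_integral_hike (hv : 1 < v) (hM : M.Feasible v) (i : Robot) {a b y : ℝ}
    (ha : 0 ≤ a) (hab : a ≤ b) (hbike : ∀ t ∈ Set.Ioc a b, y < M.bike t)
    (hy : y ≤ M.pos i b) : y - M.pos i a ≤ ∫ τ in a..b, M.hike i τ := by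
  rcases le_or_gt y (M.pos i a) with h | h
  · linarith [integral_hike_nonneg M i hab]
  have hcont : ContinuousOn (M.pos i) (Set.Icc a b) :=
    (hM.continuousOn_pos hv i).mono fun t ht => ha.trans ht.1
  have hcl : IsCompact (Set.Icc a b ∩ M.pos i ⁻¹' Set.Ici y) :=
    isCompact_Icc.of_isClosed_subset (hcont.preimage_isClosed_of_isClosed isClosed_Icc isClosed_Ici)
      Set.inter_subset_left
  -- `c` is the first time the robot is at or beyond `y`. Before `c` it is short of `y` and the bike
  -- is past `y`, so it cannot be riding.
  obtain ⟨c, ⟨⟨hac, hcb⟩, hyc⟩, hmin⟩ := hcl.exists_isLeast ⟨b, ⟨hab, le_rfl⟩, hy⟩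
  have hone : ∫ τ in a..c, M.hike i τ = c - a := by
    have : ∀ᵐ t, t ∈ Set.uIoc a c → M.hike i t = 1 := by
      have hne : ∀ᵐ t : ℝ, t ≠ c := by simp [MeasureTheory.ae_iff, MeasureTheory.measure_singleton]
      filter_upwards [hne] with t htc ht
      rw [Set.uIoc_of_le hac] at ht
      unfold hike
      rw [if_neg]
      intro hr
      have hlt : t < c := lt_of_le_of_ne ht.2 htc
      have h1 := hM.rider_at_bike i t (ha.trans ht.1.le) hr
      have h2 := hbike t ⟨ht.1, ht.2.trans hcb⟩
      exact absurd (hmin ⟨⟨ht.1.le, ht.2.trans hcb⟩, (h1 ▸ h2).le⟩) (not_le.2 hlt)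
    rw [intervalIntegral.integral_congr_ae this]
    simp
  have hsplit := intervalIntegral.integral_add_adjacent_intervals
    (hM.intervalIntegrable_hike i ha (ha.trans hac))
    (hM.intervalIntegrable_hike i (ha.trans hac) (ha.trans hab))
  have hd := hM.abs_pos_sub_le hv i ha hac
  rw [hone] at hd
  have := (abs_le.1 hd).2
  have hyc : y ≤ M.pos i c := hyc
  linarith [integral_hike_nonneg M i hcb]

/-- If both robots get from the origin to `y`, then their total hiking time is at least `y`. -/
lemma le_integral_hike (hv : 1 < v) (hM : M.Feasible v) {T y : ℝ} (hT : 0 ≤ T) (hy : 0 ≤ y)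
    (h : ∀ i, M.pos i T = y) :
    y ≤ (∫ τ in (0 : ℝ)..T, M.hike .sender τ) + ∫ τ in (0 : ℝ)..T, M.hike .receiver τ := by
  have hcont : ContinuousOn M.bike (Set.Icc 0 T) :=
    (hM.continuousOn_bike hv).mono fun t ht => ht.1
  have hcl : IsCompact (Set.Icc 0 T ∩ M.bike ⁻¹' Set.Iic y) :=
    isCompact_Icc.of_isClosed_subset (hcont.preimage_isClosed_of_isClosed isClosed_Icc isClosed_Iic)
      Set.inter_subset_left
  -- `c` is the last time the bike is not past `y`; if it ends at or before `y`, then `c = T`.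
  obtain ⟨c, ⟨⟨hc0, hcT⟩, hbc⟩, hmax⟩ :=
    hcl.exists_isGreatest ⟨0, ⟨le_rfl, hT⟩, by simpa [bike] using hy⟩
  have hbc : M.bike c ≤ y := hbc
  have hbike : ∀ t ∈ Set.Ioc c T, y < M.bike t := by
    intro t ht
    by_contra hle
    exact absurd (hmax ⟨⟨hc0.trans ht.1.le, ht.2⟩, not_lt.1 hle⟩) (not_le.2 ht.1)
  have hs : ∀ i, _ := fun i => hM.sub_pos_le_integral_hike hv i hc0 hcT hbike (h i).ge
  have hsplit : ∀ i, _ := fun i => intervalIntegral.integral_add_adjacent_intervals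
    (hM.intervalIntegrable_hike i le_rfl hc0) (hM.intervalIntegrable_hike i hc0 hT)
  -- Hiking before `c` is at least the sum of the positions at `c` minus `y`; hiking after `c` is at
  -- least `2 * y` minus that sum.
  linarith [hs .sender, hs .receiver, hsplit .sender, hsplit .receiver,
    hM.pos_add_pos_sub_bike_le hv hc0]

/-- If some robot visits `-y` before both meet at `y`, this takes a long time. -/
lemma time_bounds_of_pos (hv : 1 < v) (hM : M.Feasible v) {T t y : ℝ} (hy : 0 < y)
    (ht : 0 ≤ t) (htT : t ≤ T) (h : ∀ i, M.pos i T = y) (i : Robot) (hi : M.pos i t = -y) :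
    3 * y / v ≤ T ∧ y * (v + 3) / (2 * v) ≤ T := by
  have hv0 : 0 < v := by linarith
  have hT := ht.trans htT
  have hH := hM.le_integral_hike hv hT hy.le h
  have hpos0 : ∀ j, M.pos j 0 = 0 := fun j => by simp [pos]
  have hsplit := intervalIntegral.integral_add_adjacent_intervals
    (hM.intervalIntegrable_hike i le_rfl ht) (hM.intervalIntegrable_hike i ht hT)
  have h1 := (abs_le.1 (hM.abs_pos_sub_le hv i le_rfl ht)).1
  have h2 := (abs_le.1 (hM.abs_pos_sub_le hv i ht htT)).2
  rw [hpos0, hi] at h1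
  rw [h, hi] at h2
  -- Distance `y` from `0` to `-y`, then `2 * y` from `-y` to `y`.
  have h3 : 3 * y ≤ v * T - (v - 1) * ∫ τ in (0 : ℝ)..T, M.hike i τ := by
    rw [← hsplit]; linarith
  have h4 : ∀ j, y ≤ v * T - (v - 1) * ∫ τ in (0 : ℝ)..T, M.hike j τ := by
    intro j
    have := (abs_le.1 (hM.abs_pos_sub_le hv j le_rfl hT)).2
    rw [h, hpos0] at this
    linarith
  constructor
  · rw [div_le_iff₀ hv0]
    nlinarith [integral_hike_nonneg M i hT]
  · rw [div_le_iff₀ (by positivity)]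
    have h5 := mul_le_mul_of_nonneg_left hH (by linarith : 0 ≤ v - 1)
    cases i
    · linarith [h4 .receiver]
    · linarith [h4 .sender]

/-- If some robot visits `-x` before both meet at `x`, this takes a long time. -/
lemma time_bounds (hv : 1 < v) (hM : M.Feasible v) {T t x : ℝ} (hx : x ≠ 0)
    (ht : 0 ≤ t) (htT : t ≤ T) (h : ∀ i, M.pos i T = x) (i : Robot) (hi : M.pos i t = -x) :
    3 * |x| / v ≤ T ∧ |x| * (v + 3) / (2 * v) ≤ T := by
  rcases hx.lt_or_gt with hneg | hpos
  · rw [abs_of_neg hneg]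
    refine hM.reflect.time_bounds_of_pos hv (neg_pos.2 hneg) ht htT (fun j => ?_) i ?_
    · rw [reflect_pos, h]
    · rw [reflect_pos, hi]
  · rw [abs_of_pos hpos]
    exact hM.time_bounds_of_pos hv hpos ht htT h i hi

end Feasible

/-! ### The relay motion and the upper bound on the optimal time. -/

/-- Primitive of a step function. -/
lemma integral_step {a c₁ c₂ t : ℝ} (ha : 0 ≤ a) :
    ∫ τ in (0 : ℝ)..t, (if τ < a then c₁ else c₂) =
      if t ≤ a then c₁ * t else c₁ * a + c₂ * (t - a) := by
  have hlow : ∀ s ≤ a, ∫ τ in (0 : ℝ)..s, (if τ < a then c₁ else c₂) = c₁ * s := by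
    intro s hs
    have hne : ∀ᵐ τ : ℝ, τ ≠ a := by simp [MeasureTheory.ae_iff, MeasureTheory.measure_singleton]
    have : ∀ᵐ τ : ℝ, τ ∈ Set.uIoc 0 s → (if τ < a then c₁ else c₂) = c₁ := by
      filter_upwards [hne] with τ h1 h2
      exact if_pos (lt_of_le_of_ne (h2.2.trans (max_le ha hs)) h1)
    rw [intervalIntegral.integral_congr_ae this]
    simp [mul_comm]
  split_ifs with h
  · exact hlow t h
  · have hat : a ≤ t := (not_le.1 h).le
    have hm : Measurable fun τ : ℝ => if τ < a then c₁ else c₂ :=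
      Measurable.ite measurableSet_Iio measurable_const measurable_const
    have hb : ∀ τ : ℝ, 0 ≤ τ → |if τ < a then c₁ else c₂| ≤ max |c₁| |c₂| := by
      intro τ _
      split_ifs
      · exact le_max_left _ _
      · exact le_max_right _ _
    rw [← intervalIntegral.integral_add_adjacent_intervals
      (intervalIntegrable_of_bound hm hb le_rfl ha)
      (intervalIntegrable_of_bound hm hb ha (ha.trans hat)), hlow a le_rfl]
    have : ∫ τ in a..t, (if τ < a then c₁ else c₂) = ∫ _ in a..t, c₂ := by
      refine intervalIntegral.integral_congr fun τ hτ => ?_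
      rw [Set.uIcc_of_le hat] at hτ
      exact if_neg (not_lt.2 hτ.1)
    rw [this]
    simp [mul_comm]

/-- The relay motion towards a known exit at `2 * c > 0`: the sender bikes to `c`, leaves the bike
there and hikes on, while the receiver hikes to `c` and takes the bike from there. -/
noncomputable def relay (v c : ℝ) : Motion where
  vel i t := match i with
    | .sender => if t < c / v then v else 1
    | .receiver => if t < c then 1 else v
  rider t := if t < c / v then some .sender else if t < c then none else some .receiver

lemma relay_sender {v c : ℝ} (hv : 1 < v) (hc : 0 < c) (t : ℝ) :
    (relay v c).pos .sender t = if t ≤ c / v then v * t else c + (t - c / v) := by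
  have hv0 : 0 < v := by linarith
  have := integral_step (c₁ := v) (c₂ := 1) (t := t) (div_nonneg hc.le hv0.le)
  rw [mul_div_cancel₀ _ hv0.ne', one_mul] at this
  exact this

lemma relay_receiver {v c : ℝ} (hc : 0 < c) (t : ℝ) :
    (relay v c).pos .receiver t = if t ≤ c then t else c + v * (t - c) := by
  have := integral_step (c₁ := 1) (c₂ := v) (t := t) hc.le
  rw [one_mul, one_mul] at this
  exact this

/-- The bike rests at `c` between the two rides, so its velocity is a sum of two step functions, one
per rider. -/
lemma relay_bike {v c : ℝ} (hv : 1 < v) (hc : 0 < c) (t : ℝ) :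
    (relay v c).bike t = (if t ≤ c / v then v * t else c) + if t ≤ c then 0 else v * (t - c) := by
  have hv0 : 0 < v := by linarith
  have hlt : c / v < c := div_lt_self hc hv
  have h1 := integral_step (c₁ := v) (c₂ := 0) (t := t) (div_nonneg hc.le hv0.le)
  have h2 := integral_step (c₁ := 0) (c₂ := v) (t := t) hc.le
  rw [mul_div_cancel₀ _ hv0.ne'] at h1
  simp only [zero_mul, zero_add, add_zero] at h1 h2
  rw [← h1, ← h2, ← intervalIntegral.integral_add]
  · refine intervalIntegral.integral_congr fun τ _ => ?_
    simp only [bikeVel, relay]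
    by_cases ha : τ < c / v
    · simp [ha, ha.trans hlt]
    · by_cases hb : τ < c <;> simp [ha, hb]
  · exact (intervalIntegrable_const (c := v)).mono_fun
      (Measurable.ite measurableSet_Iio measurable_const measurable_const).aestronglyMeasurable
      (.of_forall fun τ => by dsimp only; split_ifs <;> simp)
  · exact (intervalIntegrable_const (c := v)).mono_fun
      (Measurable.ite measurableSet_Iio measurable_const measurable_const).aestronglyMeasurable
      (.of_forall fun τ => by dsimp only; split_ifs <;> simp)

lemma relay_feasible {v c : ℝ} (hv : 1 < v) (hc : 0 < c) : (relay v c).Feasible v := by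
  have hlt : c / v < c := div_lt_self hc hv
  have hrs : ∀ t, (relay v c).rider t = some .sender ↔ t < c / v := by
    intro t
    simp only [relay]
    split_ifs <;> simp_all
  have hrr : ∀ t, (relay v c).rider t = some .receiver ↔ c ≤ t := by
    intro t
    simp only [relay]
    split_ifs with h1 h2
    · simpa using h1.trans hlt
    · simpa using h2
    · simpa using h2
  refine ⟨?_, ?_, ?_, ?_, ?_⟩
  · rintro (_ | _)
    · exact Measurable.ite measurableSet_Iio measurable_const measurable_const
    · exact Measurable.ite measurableSet_Iio measurable_const measurable_const
  · rintro (_ | _)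
    · simp only [hrs]; exact measurableSet_Iio
    · simp only [hrr]; exact measurableSet_Ici
  · rintro (_ | _) t _ h
    · rw [Ne, hrs] at h
      simp [relay, h]
    · rw [Ne, hrr, not_le] at h
      simp [relay, h]
  · have habs : |v| ≤ v := (abs_of_pos (by linarith)).le
    rintro (_ | _) t _ h
    · rw [hrs] at h
      simpa [relay, h] using habs
    · rw [hrr] at h
      simpa [relay, not_lt.2 h] using habs
  · rintro (_ | _) t _ h
    · rw [hrs] at h
      rw [relay_bike hv hc, relay_sender hv hc, if_pos h.le, if_pos h.le, if_pos (h.trans hlt).le,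
        add_zero]
    · rw [hrr] at h
      rw [relay_bike hv hc, relay_receiver hc, if_neg (not_le.2 (hlt.trans_le h))]
      split_ifs with h1
      · linarith
      · rfl

end Motion

lemma optTime_le_of_pos {v x : ℝ} (hv : 1 < v) (hx : 0 < x) (M : Motion) (hM : M.Feasible v)
    {y : ℝ} (h : ∀ i, M.pos i (x * (v + 1) / (2 * v)) = y) :
    optTime v y ≤ ENNReal.ofReal (x * (v + 1) / (2 * v)) := by
  refine iInf₂_le_of_le M hM (iInf₂_le _ ⟨?_, h⟩)
  have : 0 < v := by linarith
  positivity

/-- With a known exit at `x`, time `|x| (v + 1) / (2 v)` suffices. -/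
lemma optTime_le {v x : ℝ} (hv : 1 < v) (hx : x ≠ 0) :
    optTime v x ≤ ENNReal.ofReal (|x| * (v + 1) / (2 * v)) := by
  have hv0 : 0 < v := by linarith
  have hc : 0 < |x| / 2 := by have := abs_pos.2 hx; positivity
  have hpos : ∀ i, (Motion.relay v (|x| / 2)).pos i (|x| * (v + 1) / (2 * v)) = |x| := by
    -- Each robot hikes one half of the way and bikes the other, so both arrive at the same time.
    have e : |x| * (v + 1) / (2 * v) = |x| / 2 + |x| / 2 / v := by field_simp
    have hq : 0 < |x| / 2 / v := by positivity
    rintro (_ | _)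
    · rw [Motion.relay_sender hv hc, e, if_neg (by linarith)]
      ring
    · rw [Motion.relay_receiver hc, e, if_neg (by linarith)]
      field_simp
      ring
  have hf := Motion.relay_feasible hv hc
  rcases hx.lt_or_gt with hneg | hp
  · refine optTime_le_of_pos hv (abs_pos.2 hx) _ hf.reflect fun i => ?_
    rw [Motion.reflect_pos, hpos, abs_of_neg hneg, neg_neg]
  · refine optTime_le_of_pos hv (abs_pos.2 hx) _ hf fun i => ?_
    rw [hpos, abs_of_pos hp]

/-! ### Indistinguishability and the adversary. -/

/-- Motions with the same actions on `[0, t)` have the same positions on `[0, t]`. -/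
lemma pos_bike_eq_of_agree {M N : Motion} {t : ℝ}
    (h : ∀ τ ∈ Set.Ico 0 t, (∀ i, M.vel i τ = N.vel i τ) ∧ M.rider τ = N.rider τ) :
    ∀ τ ∈ Set.Icc 0 t, (∀ i, M.pos i τ = N.pos i τ) ∧ M.bike τ = N.bike τ := by
  intro τ hτ
  have key : ∀ f g : ℝ → ℝ, (∀ s ∈ Set.Ico 0 t, f s = g s) →
      ∫ s in (0 : ℝ)..τ, f s = ∫ s in (0 : ℝ)..τ, g s := by
    intro f g hfg
    have hne : ∀ᵐ s : ℝ, s ≠ t := by simp [MeasureTheory.ae_iff, MeasureTheory.measure_singleton]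
    refine intervalIntegral.integral_congr_ae ?_
    filter_upwards [hne] with s h1 h2
    rw [Set.uIoc_of_le hτ.1] at h2
    exact hfg s ⟨h2.1.le, lt_of_le_of_ne (h2.2.trans hτ.2) h1⟩
  refine ⟨fun i => key _ _ fun s hs => (h s hs).1 i, key _ _ fun s hs => ?_⟩
  simp only [Motion.bikeVel, (h s hs).2, (h s hs).1]

namespace Algorithm

variable {v : ℝ} (A : Algorithm v)

/-- As long as no robot visits `x` or `y`, the algorithm acts in the same way for both exits. -/
lemma agree_of_not_visited {x y t : ℝ}
    (hvis : ∀ τ, 0 ≤ τ → τ < t → ∀ i, (A.run x).pos i τ ≠ x ∧ (A.run x).pos i τ ≠ y) :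
    ∀ τ ∈ Set.Ico 0 t, (∀ i, (A.run x).vel i τ = (A.run y).vel i τ) ∧
      (A.run x).rider τ = (A.run y).rider τ := by
  set P : ℝ → Prop := fun τ => (∀ i, (A.run x).vel i τ = (A.run y).vel i τ) ∧
      (A.run x).rider τ = (A.run y).rider τ with hP
  -- Agreement before `s` gives equal positions up to and including `s`, so both robots have equal
  -- information at `s` and act alike a little longer.
  have step : ∀ s, 0 ≤ s → s < t → (∀ τ ∈ Set.Ico 0 s, P τ) →
      ∃ ε > 0, ∀ τ ∈ Set.Ico s (s + ε), P τ := by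
    intro s hs hst hagree
    have hpos := pos_bike_eq_of_agree hagree
    have hR : ∀ r ≤ s, ReceiverIndist x (A.run x) y (A.run y) r := by
      intro r hr τ hτ i
      obtain ⟨h1, h2⟩ := hpos τ ⟨hτ.1, hτ.2.trans hr⟩
      obtain ⟨h3, h4⟩ := hvis τ hτ.1 ((hτ.2.trans hr).trans_lt hst) i
      rw [← h1 i, ← h2]
      exact ⟨rfl, iff_of_false h3 h4, Iff.rfl⟩
    have hS : SenderIndist x (A.run x) y (A.run y) s := by
      intro τ hτ
      obtain ⟨h1, h2, h3⟩ := hR s le_rfl τ hτ .sender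
      refine ⟨h1, h2, h3, ?_, fun _ => hR τ hτ.2⟩
      rw [(hpos τ hτ).1, (hpos τ hτ).1]
    obtain ⟨ε₁, hε₁, ha₁⟩ := A.sender_causal x y s hs hS
    obtain ⟨ε₂, hε₂, ha₂⟩ := A.receiver_causal x y s hs (hR s le_rfl)
    refine ⟨min ε₁ ε₂, lt_min hε₁ hε₂, fun τ hτ => ?_⟩
    obtain ⟨hv₁, hr₁⟩ := ha₁ τ ⟨hτ.1, hτ.2.trans_le (by gcongr; exact min_le_left _ _)⟩
    obtain ⟨hv₂, hr₂⟩ := ha₂ τ ⟨hτ.1, hτ.2.trans_le (by gcongr; exact min_le_right _ _)⟩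
    refine ⟨by rintro (_ | _) <;> assumption, Option.ext ?_⟩
    rintro (_ | _) <;> assumption
  intro τ hτ
  by_contra hbad
  have hne : {s : ℝ | 0 ≤ s ∧ s < t ∧ ¬ P s}.Nonempty := ⟨τ, hτ.1, hτ.2, hbad⟩
  have hbdd : BddBelow {s : ℝ | 0 ≤ s ∧ s < t ∧ ¬ P s} := ⟨0, fun s hs => hs.1⟩
  -- Applied at the infimum of the times of disagreement, `step` gives agreement beyond the infimum,
  -- a contradiction.
  set m := sInf {s : ℝ | 0 ≤ s ∧ s < t ∧ ¬ P s} with hm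
  have hm0 : 0 ≤ m := le_csInf hne fun s hs => hs.1
  have hmt : m < t := (csInf_le hbdd ⟨hτ.1, hτ.2, hbad⟩).trans_lt hτ.2
  obtain ⟨ε, hε, hstep⟩ := step m hm0 hmt fun s hs => by
    by_contra hPs
    exact absurd (csInf_le hbdd ⟨hs.1, hs.2.trans hmt, hPs⟩) (not_le.2 hs.2)
  obtain ⟨s, ⟨hs0, hst, hPs⟩, hsm⟩ := exists_lt_of_csInf_lt hne (lt_add_of_pos_right m hε)
  exact hPs (hstep s ⟨csInf_le hbdd ⟨hs0, hst, hPs⟩, hsm⟩)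

/-- The adversary can place the exit at one of `±d` so that a robot visits the wrong point before
the robots evacuate. -/
lemma exists_wrong_visit (hv : 1 < v) {d : ℝ} :
    ∃ x, (x = d ∨ x = -d) ∧ ∀ T, 0 ≤ T → (∀ i, (A.run x).pos i T = x) →
      ∃ t, 0 ≤ t ∧ t ≤ T ∧ ∃ i, (A.run x).pos i t = -x := by
  by_cases hE : ∃ T, 0 ≤ T ∧ ∀ i, (A.run d).pos i T = d
  swap
  -- If the run for `d` never evacuates, the condition for `x = d` is vacuous.
  · exact ⟨d, .inl rfl, fun T hT h => absurd ⟨T, hT, h⟩ hE⟩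
  obtain ⟨T₀, hT₀, hpos₀⟩ := hE
  have hcl : IsCompact (⋃ i ∈ ({.sender, .receiver} : Set Robot),
      Set.Icc 0 T₀ ∩ (A.run d).pos i ⁻¹' {d, -d}) := by
    refine Set.Finite.isCompact_biUnion (Set.toFinite _) fun i _ => ?_
    refine isCompact_Icc.of_isClosed_subset (ContinuousOn.preimage_isClosed_of_isClosed ?_
      isClosed_Icc (Set.toFinite _).isClosed) Set.inter_subset_left
    exact ((A.feasible d).continuousOn_pos hv i).mono fun t ht => ht.1
  have hmem : ∀ t, (t ∈ ⋃ i ∈ ({.sender, .receiver} : Set Robot),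
      Set.Icc 0 T₀ ∩ (A.run d).pos i ⁻¹' {d, -d}) ↔
      ∃ i, (0 ≤ t ∧ t ≤ T₀) ∧ ((A.run d).pos i t = d ∨ (A.run d).pos i t = -d) := by
    intro t
    simp only [Set.mem_iUnion, exists_prop]
    refine exists_congr fun i => and_iff_right ?_
    cases i <;> simp
  -- `t₁` is the first time any robot is at `d` or `-d` in the run for `d`.
  obtain ⟨t₁, ht₁, hmin⟩ := hcl.exists_isLeast
    ⟨T₀, (hmem T₀).2 ⟨.sender, ⟨hT₀, le_rfl⟩, .inl (hpos₀ _)⟩⟩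
  obtain ⟨i, ⟨h0, hle⟩, hi⟩ := (hmem t₁).1 ht₁
  have hnot : ∀ τ, 0 ≤ τ → τ < t₁ → ∀ i, (A.run d).pos i τ ≠ d ∧ (A.run d).pos i τ ≠ -d := by
    intro τ hτ hlt j
    rw [← not_or]
    exact fun hor => absurd (hmin ((hmem τ).2 ⟨j, ⟨hτ, hlt.le.trans hle⟩, hor⟩)) (not_le.2 hlt)
  rcases hi with hi | hi
  -- The first visit is to `d`, so the exit goes to `-d`; positions agree up to and including `t₁`,
  -- so the run for `-d` makes the same visit.
  · have hagree := pos_bike_eq_of_agree (A.agree_of_not_visited hnot)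
    refine ⟨-d, .inr rfl, fun T hT hT' => ⟨t₁, h0, ?_, i, ?_⟩⟩
    · by_contra hlt
      have hlt := not_le.1 hlt
      refine (hnot T hT hlt .sender).2 ?_
      rw [(hagree T ⟨hT, hlt.le⟩).1, hT']
    · rw [← (hagree t₁ ⟨h0, le_rfl⟩).1, hi, neg_neg]
  · refine ⟨d, .inl rfl, fun T hT hT' => ⟨t₁, h0, ?_, i, hi⟩⟩
    by_contra hlt
    exact (hnot T hT (not_le.1 hlt) .sender).1 (hT' _)

/-! ### From evacuation times to competitive ratios. -/

/-- A lower bound on `E` at one of `±d` gives a lower bound on the ratio. -/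
lemma le_ratio (hv : 1 < v) {x r : ℝ} (hx : x ≠ 0) (hr : 0 < r)
    (h : ∀ T, 0 ≤ T → (∀ i, (A.run x).pos i T = x) → r * (|x| * (v + 1) / (2 * v)) ≤ T) :
    ENNReal.ofReal r ≤ A.ratio x := by
  have hv0 : 0 < v := by linarith
  have hx' := abs_pos.2 hx
  have hE : ENNReal.ofReal (r * (|x| * (v + 1) / (2 * v))) ≤ (A.run x).evacTime x :=
    le_iInf₂ fun T hT => ENNReal.ofReal_le_ofReal (h T hT.1 hT.2)
  have hO := optTime_le hv hx
  -- With `E ≠ 0` and a finite optimum, division in `ENNReal` is safe even without a positive lower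
  -- bound on the optimum.
  have hE0 : (A.run x).evacTime x ≠ 0 :=
    ((ENNReal.ofReal_pos.2 (by positivity)).trans_le hE).ne'
  rw [ratio, ENNReal.le_div_iff_mul_le (.inr hE0)
    (.inl (hO.trans_lt ENNReal.ofReal_lt_top).ne)]
  calc ENNReal.ofReal r * optTime v x
      ≤ ENNReal.ofReal r * ENNReal.ofReal (|x| * (v + 1) / (2 * v)) := by gcongr
    _ = ENNReal.ofReal (r * (|x| * (v + 1) / (2 * v))) := (ENNReal.ofReal_mul hr.le).symm
    _ ≤ _ := hE

/-- Both lower bounds hold for every speed `v > 1` of the bike. -/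
lemma le_ratioAtDistance (hv : 1 < v) {d : ℝ} (hd : 0 < d) :
    ENNReal.ofReal (6 / (v + 1)) ≤ A.ratioAtDistance d ∧
      ENNReal.ofReal ((v ^ 2 + 2 * v - 3) / (v ^ 2 - 1)) ≤ A.ratioAtDistance d := by
  obtain ⟨x, hx, hvisit⟩ := A.exists_wrong_visit hv (d := d)
  have hv0 : 0 < v := by linarith
  have hx0 : x ≠ 0 := by rcases hx with rfl | rfl <;> simp [hd.ne']
  have hratio : A.ratio x ≤ A.ratioAtDistance d := by
    rcases hx with rfl | rfl
    · exact le_max_left _ _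
    · exact le_max_right _ _
  have hbound : ∀ T, 0 ≤ T → (∀ i, (A.run x).pos i T = x) →
      3 * |x| / v ≤ T ∧ |x| * (v + 3) / (2 * v) ≤ T := by
    intro T hT hpos
    obtain ⟨t, ht, htT, i, hi⟩ := hvisit T hT hpos
    exact (A.feasible x).time_bounds hv hx0 ht htT hpos i hi
  -- Numerator and denominator share the factor `v - 1`.
  have hfac : (v ^ 2 + 2 * v - 3) / (v ^ 2 - 1) = (v + 3) / (v + 1) := by
    rw [div_eq_div_iff (by nlinarith) (by linarith)]
    ring
  rw [hfac]
  constructor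
  · refine (A.le_ratio hv hx0 (by positivity) fun T hT hpos => ?_).trans hratio
    refine le_of_eq_of_le ?_ (hbound T hT hpos).1
    field_simp
    norm_num
  · refine (A.le_ratio hv hx0 (by positivity) fun T hT hpos => ?_).trans hratio
    refine le_of_eq_of_le ?_ (hbound T hT hpos).2
    field_simp

lemma ratioAtDistance_le_competitiveRatio {d : ℝ} (hd : 0 < d) :
    A.ratioAtDistance d ≤ A.competitiveRatio :=
  le_iSup₂_of_le d hd le_rfl

end Algorithm

end BikeEvac

theorem theorem3 (v : ℝ) (hv : 1 < v) (A : BikeEvac.Algorithm v) :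
    (v ≤ 3 →
      ENNReal.ofReal (6 / (v + 1)) ≤ A.competitiveRatio ∧
      ∀ d : ℝ, 0 < d → ENNReal.ofReal (6 / (v + 1)) ≤ A.ratioAtDistance d) ∧
    (3 < v →
      ENNReal.ofReal ((v ^ 2 + 2 * v - 3) / (v ^ 2 - 1)) ≤ A.competitiveRatio ∧
      ∀ d : ℝ, 0 < d →
        ENNReal.ofReal ((v ^ 2 + 2 * v - 3) / (v ^ 2 - 1)) ≤ A.ratioAtDistance d) := by
  have hcr := A.ratioAtDistance_le_competitiveRatio one_pos
  exact ⟨fun _ => ⟨(A.le_ratioAtDistance hv one_pos).1.trans hcr,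
      fun d hd => (A.le_ratioAtDistance hv hd).1⟩,
    fun _ => ⟨(A.le_ratioAtDistance hv one_pos).2.trans hcr,
      fun d hd => (A.le_ratioAtDistance hv hd).2⟩⟩
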